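/- Let $W\in\mathbb{R}^{n\times n}$ be a row-stochastic matrix whose directed graph on $\mathcal V=[n]$ (with a link from $i$ to $j$ if and only if $W_{ji}>0$) is strongly connected, let $\Theta=\mathrm{diag}(\theta_1,\dots,\theta_n)$ with $\theta\le\theta_i\le 1$ for all $i$, where $\theta>0$, let $\omega\in(0,1)$, and let $\mathcal S\subset\mathcal V$ contain at least one agent $i$ with $\theta_i<1$. Let $\mathbf e_{\mathcal S}:=\sum_{j\in\mathcal S}\mathbf e_j$ and $H(\mathcal S):=\bigl(I-\omega\sum_{j\in\mathcal S}\mathbf e_j\mathbf e_j^\top\bigr)(I-\Theta)W$. Consider the Friedkin–Johnsen model $\bar{\mathbf x}(t+1)=(I-\bar\Theta)\bar W\bar{\mathbf x}(t)+\bar\Theta\bar{\mathbf x}(0)$ extended by a fully stubborn influencer $0$ linked to the agents in $\mathcal S$ with weight $\omega$, i.e. $$\bar W=\begin{pmatrix}1&\mathbf 0\\ \omega\,\mathbf e_{\mathcal S}&\bigl(I-\omega\sum_{j\in\mathcal S}\mathbf e_j\mathbf e_j^\top\bigr)W\end{pmatrix},\qquad \bar\Theta=\mathrm{diag}(1,\theta_1,\dots,\theta_n),\qquad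 \bar P=(I-(I-\bar\Theta)\bar W)^{-1}\bar\Theta .$$ Let $\mathrm{sp}_0(\mathcal S):=\frac1n\sum_{i=1}^n\bar P_{i0}$ be the social power of the influencer over the $n$ regular agents, and let $$\mathrm{sp}_0^\ell(\mathcal S):=\frac1n\mathbf 1^\top\sum_{k=0}^{\ell}H(\mathcal S)^k(I-\Theta)\,\omega\,\mathbf e_{\mathcal S}$$ be its truncation. Consider the Markov chain with absorbing states $0$ and $1',\dots,n'$, transient states $1,\dots,n$, and transition probabilities $T_{i0}=\omega(1-\theta_i)$ for $i\in\mathcal S$, $T_{i0}=0$ for $i\in\mathcal V\setminus\mathcal S$, $T_{ij}=H(\mathcal S)_{ij}$ and $T_{ii'}=\theta_i$ for $i,j\in\mathcal V$. Generate $r$ independent random walks $Y_0,Y_1,\dots,Y_{\ell+1}$ of this chain ($\ell$ steps, followed by a last step, which may be absorbing), with $Y_0$ uniformly distributed over $[n]$, and let $\mathrm{sp}_0^{\mathrm{apx}}(\mathcal S)$ be the fraction of the $r$ walks that are absorbed by the state $0$. Let $\epsilon,\delta,\sigma\in(0,1)$ and let $r,\ell$ be nonnegative integers with $$r\ \ge\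 \frac{3}{\sigma^2\epsilon^2\,\mathrm{sp}_0^\ell(\mathcal S)}\log\frac2\delta,\qquad \ell\ \ge\ \frac{\log\bigl(\theta(1-\sigma)\epsilon\,\mathrm{sp}_0^\ell(\mathcal S)\bigr)-\log\omega}{\log(1-\theta)}-2 .$$ Then $$\mathbb P\bigl(|\mathrm{sp}_0^{\mathrm{apx}}(\mathcal S)-\mathrm{sp}_0(\mathcal S)|<\epsilon\,\mathrm{sp}_0^\ell(\mathcal S)\bigr)\ \ge\ 1-\delta .$$ -/

import Mathlib

open MeasureTheory ProbabilityTheory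

namespace FJ

noncomputable section

variable {n : ℕ}

/-- The weighted graph of `W` has a link from `i` to `j` iff `W j i > 0`; it is strongly connected
if every node is joined to every node by a directed path. -/
def StronglyConnected (W : Matrix (Fin n) (Fin n) ℝ) : Prop :=
  ∀ i j : Fin n, Relation.ReflTransGen (fun a b => 0 < W b a) i j

/-- The vector `∑ j ∈ S, e_j`. -/
def ind (S : Finset (Fin n)) (i : Fin n) : ℝ := if i ∈ S then 1 else 0

/-- Weight matrix of the network extended by the influencer `none`, who is linked to the agents
in `S` with weight `ω`. -/
def augWeight (W : Matrix (Fin n) (Fin n) ℝ) (ω : ℝ) (S : Finset (Fin n)) :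
    Matrix (Option (Fin n)) (Option (Fin n)) ℝ
  | none, none => 1
  | none, some _ => 0
  | some i, none => ω * ind S i
  | some i, some j => (1 - ω * ind S i) * W i j

/-- Stubbornness in the extended network: the influencer is fully stubborn. -/
def augStub (stub : Fin n → ℝ) : Option (Fin n) → ℝ
  | none => 1
  | some i => stub i

/-- The solution matrix `(I - (I - Θ)W)⁻¹ Θ` of the Friedkin–Johnsen model
`x(t+1) = (I - Θ) W x(t) + Θ x(0)`; it maps `x(0)` to `x(∞)`. -/
def solution {ι : Type*} [Fintype ι] [DecidableEq ι] (W : Matrix ι ι ℝ) (stub : ι → ℝ) :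
    Matrix ι ι ℝ :=
  (1 - (1 - Matrix.diagonal stub) * W)⁻¹ * Matrix.diagonal stub

/-- Social power of the influencer over the `n` regular agents: the average over the agents of the
weight of the influencer's initial opinion in their final opinions. -/
def sp₀ (W : Matrix (Fin n) (Fin n) ℝ) (stub : Fin n → ℝ) (ω : ℝ) (S : Finset (Fin n)) : ℝ :=
  (1 / (n : ℝ)) * ∑ i : Fin n, solution (augWeight W ω S) (augStub stub) (some i) none

/-- `H(S) = (I - ω ∑ j ∈ S, e_j e_jᵀ) (I - Θ) W`. -/
def H (W : Matrix (Fin n) (Fin n) ℝ) (stub : Fin n → ℝ) (ω : ℝ) (S : Finset (Fin n)) :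
    Matrix (Fin n) (Fin n) ℝ :=
  (1 - ω • Matrix.diagonal (ind S)) * (1 - Matrix.diagonal stub) * W

/-- Truncated social power
`(1/n) 𝟏ᵀ (∑ k = 0, …, ℓ, H(S)ᵏ) (I - Θ) ω ∑ j ∈ S, e_j`. -/
def spTrunc (W : Matrix (Fin n) (Fin n) ℝ) (stub : Fin n → ℝ) (ω : ℝ) (S : Finset (Fin n))
    (ℓ : ℕ) : ℝ :=
  (1 / (n : ℝ)) * ∑ i : Fin n,
    ((∑ k ∈ Finset.range (ℓ + 1), H W stub ω S ^ k).mulVec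
      ((1 - Matrix.diagonal stub).mulVec (ω • ind S))) i

/-- States of the augmented Markov chain: the absorbing state of the influencer, the transient
states `i`, and the absorbing states `i'`. -/
inductive State (n : ℕ) : Type
  | influencer : State n
  | agent (i : Fin n) : State n
  | anchor (i : Fin n) : State n
  deriving DecidableEq, Fintype

instance : MeasurableSpace (State n) := ⊤

instance : DiscreteMeasurableSpace (State n) := ⟨fun _ => trivial⟩

/-- Transition matrix of the augmented Markov chain. -/
def trans (W : Matrix (Fin n) (Fin n) ℝ) (stub : Fin n → ℝ) (ω : ℝ) (S : Finset (Fin n)) :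
    Matrix (State n) (State n) ℝ
  | .influencer, .influencer => 1
  | .agent i, .influencer => ω * (1 - stub i) * ind S i
  | .agent i, .agent j => H W stub ω S i j
  | .agent i, .anchor j => if i = j then stub i else 0
  | .anchor i, .anchor j => if i = j then 1 else 0
  | _, _ => 0

/-- The uniform distribution over the transient states. -/
def start : State n → ℝ
  | .agent _ => 1 / (n : ℝ)
  | _ => 0

/-- `Y` is a random walk `Y 0, …, Y m` of `m` steps of the augmented Markov chain whose starting
state is uniform over the transient states: its law gives each trajectory `y` the mass
`start (y 0) * T (y 0) (y 1) * ⋯ * T (y (m-1)) (y m)`. -/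
structure IsWalk {Ω : Type*} [MeasurableSpace Ω] (μ : Measure Ω)
    (W : Matrix (Fin n) (Fin n) ℝ) (stub : Fin n → ℝ) (ω : ℝ) (S : Finset (Fin n)) {m : ℕ}
    (Y : Ω → Fin (m + 1) → State n) : Prop where
  measurable : Measurable Y
  law : ∀ y : Fin (m + 1) → State n,
    μ.real {x | Y x = y} =
      start (y 0) * ∏ t : Fin m, trans W stub ω S (y t.castSucc) (y t.succ)

/-- Output of the Monte Carlo algorithm on the walks `w 1, …, w r`: the fraction of them that is
absorbed by the influencer's state. -/
def spApx {r m : ℕ} (w : Fin r → Fin (m + 1) → State n) : ℝ :=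
  ((Finset.univ.filter fun k => ∃ t, w k t = State.influencer).card : ℝ) / r

end

end FJ

/-! Write `p` for the truncated power and `b = (I - Θ) ω e_S`. The error budget `ε p` splits into a
deterministic part `(1 - σ) ε p` and a random part `σ ε p`, joined by the triangle inequality.
Deterministic part: the influencer's column solves `v = H v + b`, and `H` is nonnegative with row
sums at most `1 - θ`. Cutting the Neumann series leaves `H ^ (ℓ + 1) v`, which is geometrically
small in the sup norm (`abs_spTrunc_sub_sp₀_le`); the bound on `ℓ` fits it into its share. Random
part: the influencer's state is absorbing, so hitting it within `ℓ + 1` steps means being there at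
the end. A power of the transition matrix shows that this has probability exactly `p`
(`IsWalk.measureReal_hit`). The estimate is thus a mean of `r` independent Bernoulli(`p`) variables,
and the Chernoff bound with relative deviation `σ ε` gives failure probability at most `δ`. -/

namespace FJ

open MeasureTheory ProbabilityTheory Matrix

/-! ### A multiplicative Chernoff bound -/

section Chernoff

variable {Ω : Type*} [MeasurableSpace Ω] {μ : Measure Ω} [IsProbabilityMeasure μ]

/-- The exponential of a multiple of a `{0, 1}`-valued variable is affine in that variable. -/
lemma exp_mul_eq_of_zero_or_one {x : ℝ} (hx : x = 0 ∨ x = 1) (t : ℝ) :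
    Real.exp (t * x) = 1 + (Real.exp t - 1) * x := by
  rcases hx with rfl | rfl <;> simp

lemma mgf_le_of_zero_or_one {X : Ω → ℝ} (hX : Measurable X) (h01 : ∀ x, X x = 0 ∨ X x = 1)
    (t : ℝ) : mgf X μ t ≤ Real.exp ((Real.exp t - 1) * ∫ x, X x ∂μ) := by
  have hint : Integrable X μ := Integrable.of_bound hX.aestronglyMeasurable 1
    (.of_forall fun x => by rcases h01 x with h | h <;> simp [h])
  have h : mgf X μ t = (Real.exp t - 1) * ∫ x, X x ∂μ + 1 := by
    simp only [mgf, exp_mul_eq_of_zero_or_one (h01 _)]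
    rw [integral_add (integrable_const _) (hint.const_mul _), integral_const_mul]
    simp [add_comm]
  rw [h]
  exact Real.add_one_le_exp _

variable {ι : Type*} [Fintype ι] {X : ι → Ω → ℝ} {p : ℝ}

lemma mgf_sum_le_of_zero_or_one (hX : ∀ k, Measurable (X k))
    (h01 : ∀ k x, X k x = 0 ∨ X k x = 1) (hp : ∀ k, ∫ x, X k x ∂μ = p) (hind : iIndepFun X μ)
    (t : ℝ) : mgf (∑ k, X k) μ t ≤ Real.exp ((Real.exp t - 1) * (Fintype.card ι * p)) := by
  rw [hind.mgf_sum hX]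
  calc ∏ k, mgf (X k) μ t ≤ ∏ _k : ι, Real.exp ((Real.exp t - 1) * p) :=
        Finset.prod_le_prod (fun _ _ => mgf_nonneg) fun k _ => by
          simpa only [hp k] using mgf_le_of_zero_or_one (μ := μ) (hX k) (h01 k) t
    _ = _ := by
        rw [Finset.prod_const, ← Real.exp_nat_mul, Finset.card_univ]
        ring_nf

lemma integrable_exp_mul_sum_of_zero_or_one (hX : ∀ k, Measurable (X k))
    (h01 : ∀ k x, X k x = 0 ∨ X k x = 1) (t : ℝ) :
    Integrable (fun x => Real.exp (t * (∑ k, X k) x)) μ := by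
  refine Integrable.of_bound (C := Real.exp (|t| * Fintype.card ι)) ?_ (.of_forall fun x => ?_)
  · have : Measurable (∑ k, X k) := by
      simpa only [Finset.sum_fn] using Finset.measurable_sum Finset.univ fun k _ => hX k
    exact (Real.measurable_exp.comp (this.const_mul t)).aestronglyMeasurable
  · rw [Real.norm_eq_abs, Real.abs_exp, Real.exp_le_exp, Finset.sum_apply]
    have h0 : 0 ≤ ∑ k, X k x :=
      Finset.sum_nonneg fun k _ => by rcases h01 k x with h | h <;> simp [h]
    have h1 : ∑ k, X k x ≤ Fintype.card ι := by
      calc ∑ k, X k x ≤ ∑ _k : ι, (1 : ℝ) :=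
            Finset.sum_le_sum fun k _ => by rcases h01 k x with h | h <;> simp [h]
        _ = _ := by simp
    calc t * ∑ k, X k x ≤ |t| * ∑ k, X k x := by gcongr; exact le_abs_self t
      _ ≤ _ := by gcongr

/-- Exponent of the upper tail. With `log (1 + η) ≥ 2η / (η + 2)` it reduces to `η² (1 - η) ≥ 0`,
which is where `η ≤ 1` enters. -/
lemma sub_mul_log_one_add_le {η : ℝ} (h0 : 0 ≤ η) (h1 : η ≤ 1) :
    η - (1 + η) * Real.log (1 + η) ≤ -(η ^ 2 / 3) := by
  have h := mul_le_mul_of_nonneg_left (Real.le_log_one_add_of_nonneg h0) (by linarith : 0 ≤ 1 + η)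
  have h2 : η + η ^ 2 / 3 ≤ (1 + η) * (2 * η / (η + 2)) := by
    rw [mul_div_assoc', le_div_iff₀ (by linarith)]
    nlinarith [mul_nonneg (sq_nonneg η) (sub_nonneg.2 h1)]
  linarith

/-- Inverts `exp η ≥ 1 + η + η²/2`, since `(1 + η + η²/2)(1 - η + η²/2) = 1 + η⁴/4`. -/
lemma exp_neg_le_quadratic {η : ℝ} (h0 : 0 ≤ η) : Real.exp (-η) ≤ 1 - η + η ^ 2 / 2 := by
  have h := Real.quadratic_le_exp_of_nonneg h0
  rw [Real.exp_neg]
  refine (inv_anti₀ (by positivity) h).trans ?_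
  rw [inv_le_iff_one_le_mul₀ (by positivity)]
  nlinarith [sq_nonneg (η ^ 2)]

/-- **Multiplicative Chernoff bound** for independent `{0, 1}`-valued variables with common
mean `p`. -/
theorem measure_abs_sum_sub_ge_le (hX : ∀ k, Measurable (X k))
    (h01 : ∀ k x, X k x = 0 ∨ X k x = 1) (hp : ∀ k, ∫ x, X k x ∂μ = p) (hp0 : 0 ≤ p)
    (hind : iIndepFun X μ) {η : ℝ} (h0 : 0 ≤ η) (h1 : η ≤ 1) :
    μ.real {x | η * (Fintype.card ι * p) ≤ |∑ k, X k x - Fintype.card ι * p|} ≤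
      2 * Real.exp (-(η ^ 2 / 3) * (Fintype.card ι * p)) := by
  set m : ℝ := Fintype.card ι * p with hm
  have hm0 : 0 ≤ m := by positivity
  have hup : μ.real {x | (1 + η) * m ≤ (∑ k, X k) x} ≤ Real.exp (-(η ^ 2 / 3) * m) := by
    -- The parameter `t = log (1 + η)` minimises the exponential Markov bound.
    have hlog : 0 ≤ Real.log (1 + η) := Real.log_nonneg (by linarith)
    refine (measure_ge_le_exp_mul_mgf _ hlog
      (integrable_exp_mul_sum_of_zero_or_one hX h01 _)).trans ?_
    refine (mul_le_mul_of_nonneg_left (mgf_sum_le_of_zero_or_one hX h01 hp hind _)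
      (Real.exp_nonneg _)).trans ?_
    rw [← Real.exp_add, Real.exp_le_exp, Real.exp_log (by linarith), ← hm]
    nlinarith [mul_le_mul_of_nonneg_right (sub_mul_log_one_add_le h0 h1) hm0]
  have hlo : μ.real {x | (∑ k, X k) x ≤ (1 - η) * m} ≤ Real.exp (-(η ^ 2 / 3) * m) := by
    -- The choice `t = -η` is not optimal, but it avoids `log (1 - η)` at `η = 1` and still yields
    -- the exponent `-η²/2`.
    refine (measure_le_le_exp_mul_mgf (t := -η) _ (by linarith)
      (integrable_exp_mul_sum_of_zero_or_one hX h01 _)).trans ?_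
    refine (mul_le_mul_of_nonneg_left (mgf_sum_le_of_zero_or_one hX h01 hp hind _)
      (Real.exp_nonneg _)).trans ?_
    rw [← Real.exp_add, Real.exp_le_exp, ← hm]
    nlinarith [mul_le_mul_of_nonneg_right (exp_neg_le_quadratic h0) hm0,
      mul_nonneg (sq_nonneg η) hm0]
  calc _ ≤ μ.real ({x | (1 + η) * m ≤ (∑ k, X k) x} ∪ {x | (∑ k, X k) x ≤ (1 - η) * m}) := by
        refine measureReal_mono fun x hx => ?_
        simp only [Set.mem_ofPred_eq, Set.mem_union, Finset.sum_apply] at hx ⊢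
        rcases le_abs'.1 hx with h | h
        · right; linarith
        · left; linarith
    _ ≤ _ := measureReal_union_le _ _
    _ ≤ _ := by linarith

end Chernoff

/-! ### Fixed points of contracting matrices -/

section Contraction

variable {ι : Type*} [Fintype ι] {A : Matrix ι ι ℝ} {c : ℝ}

lemma norm_mulVec_le (hA : ∀ i j, 0 ≤ A i j) (hsum : ∀ i, ∑ j, A i j ≤ c) (hc : 0 ≤ c)
    (v : ι → ℝ) : ‖A *ᵥ v‖ ≤ c * ‖v‖ := by
  refine (pi_norm_le_iff_of_nonneg (by positivity)).2 fun i => ?_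
  calc ‖(A *ᵥ v) i‖ ≤ ∑ j, ‖A i j * v j‖ := norm_sum_le _ _
    _ ≤ ∑ j, A i j * ‖v‖ := Finset.sum_le_sum fun j _ => by
        rw [norm_mul, Real.norm_of_nonneg (hA i j)]
        exact mul_le_mul_of_nonneg_left (norm_le_pi_norm v j) (hA i j)
    _ ≤ _ := by rw [← Finset.sum_mul]; gcongr; exact hsum i

variable [DecidableEq ι]

lemma norm_pow_mulVec_le (hA : ∀ v : ι → ℝ, ‖A *ᵥ v‖ ≤ c * ‖v‖) (hc : 0 ≤ c) (m : ℕ)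
    (v : ι → ℝ) : ‖(A ^ m) *ᵥ v‖ ≤ c ^ m * ‖v‖ := by
  induction m with
  | zero => simp
  | succ m ih =>
    rw [pow_succ', ← mulVec_mulVec, pow_succ', mul_assoc]
    exact (hA _).trans (by gcongr)

/-- Unrolling the equation `m` times; no contraction is needed for this identity. -/
lemma fixedPoint_sub_sum_pow {v b : ι → ℝ} (hv : v = A *ᵥ v + b) (m : ℕ) :
    v - (∑ k ∈ Finset.range m, A ^ k) *ᵥ b = (A ^ m) *ᵥ v := by
  induction m with
  | zero => simp
  | succ m ih =>
    have hb : b = v - A *ᵥ v := by rw [eq_sub_iff_add_eq, add_comm]; exact hv.symm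
    rw [Finset.sum_range_succ, add_mulVec, ← sub_sub, ih]
    conv_lhs => rw [hb]
    rw [mulVec_sub, mulVec_mulVec, ← pow_succ]
    abel

/-- Error of the truncated Neumann series for the fixed point of an affine contraction. -/
lemma norm_fixedPoint_sub_sum_pow_le (hA : ∀ v : ι → ℝ, ‖A *ᵥ v‖ ≤ c * ‖v‖) (hc : 0 ≤ c)
    (hc1 : c < 1) {v b : ι → ℝ} (hv : v = A *ᵥ v + b) (m : ℕ) :
    ‖v - (∑ k ∈ Finset.range m, A ^ k) *ᵥ b‖ ≤ c ^ m * (‖b‖ / (1 - c)) := by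
  rw [fixedPoint_sub_sum_pow hv]
  refine (norm_pow_mulVec_le hA hc m v).trans ?_
  gcongr
  rw [le_div_iff₀ (by linarith)]
  have h : ‖v‖ ≤ ‖A *ᵥ v‖ + ‖b‖ := by
    conv_lhs => rw [hv]
    exact norm_add_le _ _
  linarith [hA v]

end Contraction

/-! ### The social power and its truncation -/

section SocialPower

variable {n : ℕ} {W : Matrix (Fin n) (Fin n) ℝ} {stub : Fin n → ℝ} {ω θ : ℝ}
  {S : Finset (Fin n)}

lemma ind_nonneg (S : Finset (Fin n)) (i : Fin n) : 0 ≤ ind S i := by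
  unfold ind; split_ifs <;> simp

lemma ind_le_one (S : Finset (Fin n)) (i : Fin n) : ind S i ≤ 1 := by
  unfold ind; split_ifs <;> simp

lemma H_apply (i j : Fin n) :
    H W stub ω S i j = (1 - ω * ind S i) * (1 - stub i) * W i j := by
  have h1 : (1 - ω • diagonal (ind S) : Matrix (Fin n) (Fin n) ℝ) =
      diagonal fun i => 1 - ω * ind S i := by
    ext a b; by_cases h : a = b <;> simp [h]
  have h2 : (1 - diagonal stub : Matrix (Fin n) (Fin n) ℝ) = diagonal fun i => 1 - stub i := by
    ext a b; by_cases h : a = b <;> simp [h]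
  rw [H, h1, h2, diagonal_mul_diagonal, diagonal_mul]

lemma one_sub_stub_mulVec_apply (i : Fin n) :
    ((1 - diagonal stub) *ᵥ (ω • ind S)) i = ω * (1 - stub i) * ind S i := by
  rw [sub_mulVec, one_mulVec, Pi.sub_apply, mulVec_diagonal]
  simp only [Pi.smul_apply, smul_eq_mul]
  ring

lemma one_sub_mul_ind_mem (hω : ω ∈ Set.Ioo (0 : ℝ) 1) (i : Fin n) :
    1 - ω * ind S i ∈ Set.Icc (0 : ℝ) 1 := by
  have h0 := ind_nonneg S i
  have h1 := ind_le_one S i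
  constructor <;> nlinarith [hω.1, hω.2, mul_nonneg hω.1.le h0]

lemma H_nonneg (hW : W ∈ rowStochastic ℝ (Fin n)) (hω : ω ∈ Set.Ioo (0 : ℝ) 1)
    (hstub : ∀ i, stub i ≤ 1) (i j : Fin n) : 0 ≤ H W stub ω S i j := by
  rw [H_apply]
  exact mul_nonneg (mul_nonneg (one_sub_mul_ind_mem hω i).1 (sub_nonneg.2 (hstub i))) (hW.1 i j)

lemma sum_H_le (hW : W ∈ rowStochastic ℝ (Fin n)) (hω : ω ∈ Set.Ioo (0 : ℝ) 1)
    (hstub : ∀ i, stub i ∈ Set.Icc θ 1) (i : Fin n) : ∑ j, H W stub ω S i j ≤ 1 - θ := by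
  simp only [H_apply]
  rw [← Finset.mul_sum, sum_row_of_mem_rowStochastic hW, mul_one]
  have h := one_sub_mul_ind_mem (S := S) hω i
  nlinarith [h.2, (hstub i).1, mul_nonneg (sub_nonneg.2 h.2) (sub_nonneg.2 (hstub i).2)]

lemma norm_H_mulVec_le (hW : W ∈ rowStochastic ℝ (Fin n)) (hω : ω ∈ Set.Ioo (0 : ℝ) 1)
    (hstub : ∀ i, stub i ∈ Set.Icc θ 1) (hθ1 : θ ≤ 1) (v : Fin n → ℝ) :
    ‖H W stub ω S *ᵥ v‖ ≤ (1 - θ) * ‖v‖ :=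
  norm_mulVec_le (H_nonneg hW hω fun i => (hstub i).2) (sum_H_le hW hω hstub)
    (sub_nonneg.2 hθ1) v

lemma norm_one_sub_stub_mulVec_le (hω : ω ∈ Set.Ioo (0 : ℝ) 1)
    (hstub : ∀ i, stub i ∈ Set.Icc θ 1) (hθ1 : θ ≤ 1) :
    ‖(1 - diagonal stub) *ᵥ (ω • ind S)‖ ≤ ω * (1 - θ) := by
  have hω0 := hω.1
  have h1 : 0 ≤ 1 - θ := sub_nonneg.2 hθ1
  refine (pi_norm_le_iff_of_nonneg (by positivity)).2 fun i => ?_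
  have h2 : 0 ≤ 1 - stub i := sub_nonneg.2 (hstub i).2
  have h3 := ind_nonneg S i
  rw [one_sub_stub_mulVec_apply, Real.norm_of_nonneg (by positivity)]
  calc ω * (1 - stub i) * ind S i ≤ ω * (1 - θ) * 1 := by
        gcongr
        exacts [(hstub i).1, ind_le_one S i]
    _ = _ := mul_one _

lemma one_sub_aug_mulVec_none (v : Option (Fin n) → ℝ) :
    ((1 - (1 - diagonal (augStub stub)) * augWeight W ω S) *ᵥ v) none = v none := by
  have h2 : (1 - diagonal (augStub stub) : Matrix (Option (Fin n)) (Option (Fin n)) ℝ) =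
      diagonal fun i => 1 - augStub stub i := by
    ext a b; by_cases h : a = b <;> simp [h]
  rw [sub_mulVec, one_mulVec, Pi.sub_apply, h2]
  simp [mulVec, dotProduct, augStub, diagonal_mul]

/-- Block form of the extended system: the diagonal factors commute, so the agents' block is `H` and
the influencer's column is `b`. -/
lemma one_sub_aug_mulVec_some (v : Option (Fin n) → ℝ) (i : Fin n) :
    ((1 - (1 - diagonal (augStub stub)) * augWeight W ω S) *ᵥ v) (some i) =
      v (some i) - ((H W stub ω S *ᵥ fun j => v (some j)) i +
        v none * ((1 - diagonal stub) *ᵥ (ω • ind S)) i) := by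
  have h2 : (1 - diagonal (augStub stub) : Matrix (Option (Fin n)) (Option (Fin n)) ℝ) =
      diagonal fun i => 1 - augStub stub i := by
    ext a b; by_cases h : a = b <;> simp [h]
  rw [sub_mulVec, one_mulVec, Pi.sub_apply, h2, one_sub_stub_mulVec_apply]
  simp only [mulVec, dotProduct, diagonal_mul, Fintype.sum_option, augStub, augWeight, H_apply]
  congr 1
  rw [add_comm]
  congr 1
  · exact Finset.sum_congr rfl fun j _ => by ring
  · ring

/-- A kernel vector vanishes at the influencer, so its agent part is fixed by the strict contraction
`H` and is zero. -/
lemma isUnit_one_sub_aug (hW : W ∈ rowStochastic ℝ (Fin n)) (hω : ω ∈ Set.Ioo (0 : ℝ) 1)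
    (hθ : 0 < θ) (hstub : ∀ i, stub i ∈ Set.Icc θ 1) (hθ1 : θ ≤ 1) :
    IsUnit (1 - (1 - diagonal (augStub stub)) * augWeight W ω S) := by
  rw [← mulVec_injective_iff_isUnit, ← coe_mulVecLin, injective_iff_map_eq_zero]
  intro v hv
  rw [mulVecLin_apply] at hv
  have hnone : v none = 0 := by
    rw [← one_sub_aug_mulVec_none (W := W) (stub := stub) (ω := ω) (S := S) v, hv]; rfl
  have hsome : (fun j => v (some j)) = H W stub ω S *ᵥ fun j => v (some j) := by
    funext i
    have h := congrFun hv (some i)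
    rw [one_sub_aug_mulVec_some, hnone, zero_mul, add_zero] at h
    exact sub_eq_zero.1 h
  have hnorm : ‖fun j => v (some j)‖ = 0 := by
    have h := norm_H_mulVec_le (S := S) hW hω hstub hθ1 fun j => v (some j)
    rw [← hsome] at h
    nlinarith [norm_nonneg fun j => v (some j)]
  funext i
  cases i with
  | none => exact hnone
  | some i => exact congrFun (norm_eq_zero.1 hnorm) i

/-- The influencer's column of the solution matrix is the fixed point of `v ↦ H v + (I - Θ) ω e_S`. -/
lemma solution_column_eq (hW : W ∈ rowStochastic ℝ (Fin n)) (hω : ω ∈ Set.Ioo (0 : ℝ) 1)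
    (hθ : 0 < θ) (hstub : ∀ i, stub i ∈ Set.Icc θ 1) (hθ1 : θ ≤ 1) :
    (fun i => solution (augWeight W ω S) (augStub stub) (some i) none) =
      H W stub ω S *ᵥ (fun i => solution (augWeight W ω S) (augStub stub) (some i) none) +
        (1 - diagonal stub) *ᵥ (ω • ind S) := by
  have hdet := (isUnit_iff_isUnit_det _).1 (isUnit_one_sub_aug (S := S) hW hω hθ hstub hθ1)
  have hcol : (1 - (1 - diagonal (augStub stub)) * augWeight W ω S) *ᵥ
      (fun i => solution (augWeight W ω S) (augStub stub) i none) =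
      fun i => diagonal (augStub stub) i none := by
    have h : (1 - (1 - diagonal (augStub stub)) * augWeight W ω S) *
        solution (augWeight W ω S) (augStub stub) = diagonal (augStub stub) := by
      rw [solution, ← mul_assoc, mul_nonsing_inv _ hdet, one_mul]
    funext i
    exact congrFun (congrFun h i) none
  have hnone : solution (augWeight W ω S) (augStub stub) none none = 1 := by
    have h := congrFun hcol none
    rwa [one_sub_aug_mulVec_none, diagonal_apply_eq] at h
  funext i
  have h := congrFun hcol (some i)
  rw [one_sub_aug_mulVec_some, hnone, one_mul, diagonal_apply_ne _ (by simp)] at h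
  exact sub_eq_zero.1 h

lemma abs_average_le (hn : 0 < n) {u : Fin n → ℝ} : |1 / (n : ℝ) * ∑ i, u i| ≤ ‖u‖ := by
  have hn' : (0 : ℝ) < n := by exact_mod_cast hn
  rw [abs_mul, abs_of_pos (by positivity), one_div, inv_mul_le_iff₀ hn']
  calc |∑ i, u i| ≤ ∑ i, |u i| := Finset.abs_sum_le_sum_abs _ _
    _ ≤ ∑ _i : Fin n, ‖u‖ := Finset.sum_le_sum fun i _ => norm_le_pi_norm u i
    _ = _ := by simp

theorem abs_spTrunc_sub_sp₀_le (hn : 0 < n) (hW : W ∈ rowStochastic ℝ (Fin n))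
    (hω : ω ∈ Set.Ioo (0 : ℝ) 1) (hθ : 0 < θ) (hstub : ∀ i, stub i ∈ Set.Icc θ 1) (hθ1 : θ ≤ 1)
    (ℓ : ℕ) : |spTrunc W stub ω S ℓ - sp₀ W stub ω S| ≤ ω * (1 - θ) ^ (ℓ + 2) / θ := by
  have hc : 0 ≤ 1 - θ := sub_nonneg.2 hθ1
  have h := norm_fixedPoint_sub_sum_pow_le (norm_H_mulVec_le (S := S) hW hω hstub hθ1) hc
    (by linarith) (solution_column_eq hW hω hθ hstub hθ1) (ℓ + 1)
  rw [abs_sub_comm, sp₀, spTrunc, ← mul_sub, ← Finset.sum_sub_distrib]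
  refine (abs_average_le hn).trans (h.trans ?_)
  -- The exponent `ℓ + 2` comes from the `ℓ + 1` summed powers and one more factor `1 - θ` contained
  -- in `b`.
  rw [sub_sub_cancel]
  calc (1 - θ) ^ (ℓ + 1) * (‖(1 - diagonal stub) *ᵥ (ω • ind S)‖ / θ)
      ≤ (1 - θ) ^ (ℓ + 1) * (ω * (1 - θ) / θ) := by
        gcongr; exact norm_one_sub_stub_mulVec_le hω hstub hθ1
    _ = _ := by ring

lemma pow_H_nonneg (hW : W ∈ rowStochastic ℝ (Fin n)) (hω : ω ∈ Set.Ioo (0 : ℝ) 1)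
    (hstub : ∀ i, stub i ≤ 1) (k : ℕ) (i j : Fin n) : 0 ≤ (H W stub ω S ^ k) i j := by
  induction k generalizing i j with
  | zero => rw [pow_zero, one_apply]; split_ifs <;> simp
  | succ k ih =>
    rw [pow_succ, mul_apply]
    exact Finset.sum_nonneg fun l _ => mul_nonneg (ih i l) (H_nonneg hW hω hstub l j)

/-- The term `k = 0` alone is positive at a non-fully-stubborn agent of `S`, and all other terms are
nonnegative. -/
theorem spTrunc_pos (hW : W ∈ rowStochastic ℝ (Fin n)) (hω : ω ∈ Set.Ioo (0 : ℝ) 1)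
    (hstub : ∀ i, stub i ≤ 1) (hS : ∃ i ∈ S, stub i < 1) (ℓ : ℕ) :
    0 < spTrunc W stub ω S ℓ := by
  obtain ⟨a, haS, ha⟩ := hS
  have hn : (0 : ℝ) < n := by exact_mod_cast a.pos
  set b : Fin n → ℝ := (1 - diagonal stub) *ᵥ (ω • ind S) with hb
  have hb0 : ∀ i, 0 ≤ b i := fun i => by
    rw [hb, one_sub_stub_mulVec_apply]
    exact mul_nonneg (mul_nonneg hω.1.le (sub_nonneg.2 (hstub i))) (ind_nonneg S i)
  have hba : 0 < b a := by
    rw [hb, one_sub_stub_mulVec_apply, ind, if_pos haS, mul_one]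
    exact mul_pos hω.1 (sub_pos.2 ha)
  have hge : ∀ i, b i ≤ ((∑ k ∈ Finset.range (ℓ + 1), H W stub ω S ^ k) *ᵥ b) i := fun i => by
    rw [Finset.sum_range_succ', add_mulVec, pow_zero, one_mulVec, Pi.add_apply,
      le_add_iff_nonneg_left]
    rw [mulVec, dotProduct]
    refine Finset.sum_nonneg fun j _ => mul_nonneg ?_ (hb0 j)
    rw [Matrix.sum_apply]
    exact Finset.sum_nonneg fun k _ => pow_H_nonneg hW hω hstub _ i j
  rw [spTrunc]
  refine mul_pos (by positivity) (Finset.sum_pos' (fun i _ => (hb0 i).trans (hge i))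
    ⟨a, Finset.mem_univ a, hba.trans_le (hge a)⟩)

end SocialPower

/-! ### Absorption of the random walk -/

section Walk

/-- Summing path weights over all paths from `s` to `e` gives an entry of the matrix power. -/
lemma sum_path_eq_pow {α : Type*} [Fintype α] [DecidableEq α] (T : Matrix α α ℝ) (m : ℕ)
    (f : α → ℝ) (e : α) :
    ∑ y : Fin (m + 1) → α, (if y (Fin.last m) = e then
      f (y 0) * ∏ t : Fin m, T (y t.castSucc) (y t.succ) else 0) = (f ᵥ* T ^ m) e := by
  induction m generalizing f with
  | zero =>
    rw [← (Equiv.funUnique (Fin 1) α).symm.sum_comp]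
    simp [Equiv.funUnique, uniqueElim]
  | succ m ih =>
    -- Summing out the first state replaces the initial weight `f` by `f ᵥ* T`; hence the induction
    -- generalizes `f`.
    rw [pow_succ', ← vecMul_vecMul, ← ih, ← (Fin.consEquiv fun _ => α).sum_comp,
      Fintype.sum_prod_type, Finset.sum_comm]
    refine Finset.sum_congr rfl fun y _ => ?_
    simp only [Fin.consEquiv, Equiv.coe_fn_mk, ← Fin.succ_last, Fin.cons_succ, Fin.cons_zero,
      Fin.prod_univ_succ, Fin.castSucc_zero, ← Fin.succ_castSucc]
    split_ifs
    · simp only [vecMul, dotProduct, Finset.sum_mul, mul_assoc]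
    · simp

variable {n : ℕ} {W : Matrix (Fin n) (Fin n) ℝ} {stub : Fin n → ℝ} {ω : ℝ}
  {S : Finset (Fin n)}

lemma sum_state (f : State n → ℝ) :
    ∑ s, f s = f .influencer + ∑ i, f (.agent i) + ∑ i, f (.anchor i) := by
  let e : Unit ⊕ Fin n ⊕ Fin n ≃ State n :=
    { toFun := Sum.elim (fun _ => .influencer) (Sum.elim .agent .anchor)
      invFun := fun s => match s with
        | .influencer => .inl ()
        | .agent i => .inr (.inl i)
        | .anchor i => .inr (.inr i)
      left_inv := by rintro (_ | _ | _) <;> rfl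
      right_inv := by rintro (_ | _ | _) <;> rfl }
  rw [← e.sum_comp]
  simp [e, add_assoc]

/-- First-step analysis: from an agent, the walk is absorbed at once with probability `b i`, or
moves on by `H`, or is lost to an anchor. -/
lemma trans_pow_influencer (m : ℕ) :
    (trans W stub ω S ^ m) .influencer .influencer = 1 ∧
    (∀ i, (trans W stub ω S ^ m) (.anchor i) .influencer = 0) ∧
    ∀ i, (trans W stub ω S ^ m) (.agent i) .influencer =
      ((∑ k ∈ Finset.range m, H W stub ω S ^ k) *ᵥ ((1 - diagonal stub) *ᵥ (ω • ind S))) i := by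
  induction m with
  | zero => simp
  | succ m ih =>
    obtain ⟨h1, h2, h3⟩ := ih
    refine ⟨?_, fun i => ?_, fun i => ?_⟩
    · rw [pow_succ', mul_apply, sum_state]
      simp [trans, h1]
    · rw [pow_succ', mul_apply, sum_state]
      simp [trans, h2]
    · rw [pow_succ', mul_apply, sum_state, h1, Finset.sum_range_succ']
      simp only [h2, h3, mul_zero, Finset.sum_const_zero, add_zero, pow_succ', mul_one]
      rw [← Finset.mul_sum, add_mulVec, ← mulVec_mulVec, pow_zero, one_mulVec, Pi.add_apply,
        one_sub_stub_mulVec_apply, add_comm]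
      rfl

/-- A path of positive weight that visits the influencer's state ends there. -/
lemma last_eq_influencer {m : ℕ} {y : Fin (m + 1) → State n}
    (hy : ∏ t : Fin m, trans W stub ω S (y t.castSucc) (y t.succ) ≠ 0)
    (hit : ∃ t, y t = .influencer) : y (Fin.last m) = .influencer := by
  obtain ⟨t, ht⟩ := hit
  have hstep : ∀ s : Fin m, y s.castSucc = .influencer → y s.succ = .influencer := by
    intro s hs
    have h := Finset.prod_ne_zero_iff.1 hy s (Finset.mem_univ s)
    rw [hs] at h
    cases hs' : y s.succ <;> simp [hs', trans] at h ⊢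
  have hmono : ∀ s, t ≤ s → y s = .influencer := by
    intro s
    induction s using Fin.induction with
    | zero => intro h; rwa [← Fin.le_zero_iff.1 h]
    | succ s ih =>
      intro h
      rcases h.eq_or_lt with h | h
      · rwa [← h]
      · exact hstep s (ih (Fin.le_castSucc_iff.2 h))
  exact hmono _ (Fin.le_last t)

theorem IsWalk.measureReal_hit {Ω : Type*} [MeasurableSpace Ω] {μ : Measure Ω}
    [IsProbabilityMeasure μ] {ℓ : ℕ} {Y : Ω → Fin (ℓ + 1 + 1) → State n}
    (hY : IsWalk μ W stub ω S Y) :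
    μ.real {x | ∃ t, Y x t = .influencer} = spTrunc W stub ω S ℓ := by
  classical
  have hset : {x | ∃ t, Y x t = .influencer} =
      ⋃ y ∈ Finset.univ.filter (fun y : Fin (ℓ + 1 + 1) → State n => ∃ t, y t = .influencer),
        {x | Y x = y} := by
    ext x; simp
  rw [hset, measureReal_biUnion_finset]
  · simp only [hY.law]
    have hsum := sum_path_eq_pow (trans W stub ω S) (ℓ + 1) start .influencer
    rw [Finset.sum_filter]
    refine Eq.trans (Finset.sum_congr rfl fun y _ => ?_) (hsum.trans ?_)
    · by_cases h0 : ∏ t : Fin (ℓ + 1), trans W stub ω S (y t.castSucc) (y t.succ) = 0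
      · simp [h0]
      · exact if_congr ⟨last_eq_influencer h0, fun h => ⟨_, h⟩⟩ rfl rfl
    · rw [vecMul, dotProduct, sum_state]
      simp only [start, (trans_pow_influencer (ℓ + 1)).2.2, zero_mul, Finset.sum_const_zero,
        zero_add, add_zero]
      rw [← Finset.mul_sum]
      rfl
  · intro y _ z _ hyz
    exact Set.disjoint_left.2 fun x hx hx' => hyz (hx.symm.trans hx')
  · exact fun y _ => hY.measurable (measurableSet_singleton y)

end Walk

/-! ### The Monte Carlo estimate -/

section MonteCarlo

variable {n : ℕ} {W : Matrix (Fin n) (Fin n) ℝ} {stub : Fin n → ℝ} {ω : ℝ}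
  {S : Finset (Fin n)}

/-- The Monte Carlo estimate concentrates around the truncated social power. -/
theorem measureReal_abs_spApx_sub_ge_le {Ω : Type*} [MeasurableSpace Ω] {μ : Measure Ω}
    [IsProbabilityMeasure μ] {r ℓ : ℕ} {Y : Fin r → Ω → Fin (ℓ + 1 + 1) → State n}
    (hY : ∀ k, IsWalk μ W stub ω S (Y k)) (hindep : iIndepFun Y μ) (hr : 0 < r)
    (hp : 0 ≤ spTrunc W stub ω S ℓ) {η : ℝ} (h0 : 0 ≤ η) (h1 : η ≤ 1) :
    μ.real {x | η * spTrunc W stub ω S ℓ ≤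
        |spApx (fun k => Y k x) - spTrunc W stub ω S ℓ|} ≤
      2 * Real.exp (-(η ^ 2 / 3) * (r * spTrunc W stub ω S ℓ)) := by
  classical
  let g : (Fin (ℓ + 1 + 1) → State n) → ℝ := fun y => if ∃ t, y t = .influencer then 1 else 0
  have hg : Measurable g := measurable_of_finite g
  have hint : ∀ k, ∫ x, (g ∘ Y k) x ∂μ = spTrunc W stub ω S ℓ := by
    intro k
    have hind : g ∘ Y k = Set.indicator {x | ∃ t, Y k x t = .influencer} 1 := by
      funext x; simp [g, Set.indicator_apply]
    have hm : MeasurableSet {x | ∃ t, Y k x t = .influencer} :=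
      (hY k).measurable (Set.toFinite {y : Fin (ℓ + 1 + 1) → State n | ∃ t, y t = .influencer}).measurableSet
    rw [hind, integral_indicator_one hm, (hY k).measureReal_hit]
  have h := measure_abs_sum_sub_ge_le (fun k => hg.comp (hY k).measurable)
    (fun k x => by simp only [g, Function.comp]; split_ifs <;> simp) hint hp
    (hindep.comp (fun _ => g) fun _ => hg) h0 h1
  rw [Fintype.card_fin] at h
  refine le_trans (measureReal_mono fun x hx => ?_) h
  have hr' : (0 : ℝ) < r := by exact_mod_cast hr
  have hx' : ∑ k, (g ∘ Y k) x = r * spApx (fun k => Y k x) := by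
    rw [spApx, mul_div_cancel₀ _ hr'.ne']
    simp [g]
  rw [Set.mem_ofPred_eq] at hx ⊢
  rw [hx', ← mul_sub, abs_mul, abs_of_pos hr', mul_left_comm]
  exact mul_le_mul_of_nonneg_left hx hr'.le

end MonteCarlo

/-- The required number of steps makes the truncation error small. -/
lemma truncation_error_le {ω θ a : ℝ} {ℓ : ℕ} (hω : 0 < ω) (hθ : 0 < θ) (hθ1 : θ < 1)
    (ha : 0 < a)
    (hℓ : (Real.log (θ * a) - Real.log ω) / Real.log (1 - θ) - 2 ≤ ℓ) :
    ω * (1 - θ) ^ (ℓ + 2) / θ ≤ a := by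
  have hlog : Real.log (1 - θ) < 0 := Real.log_neg (by linarith) (by linarith)
  have h1 : (ℓ + 2 : ℝ) * Real.log (1 - θ) ≤ Real.log (θ * a) - Real.log ω := by
    rw [← div_le_iff_of_neg hlog]; linarith
  have h2 : Real.log (ω * (1 - θ) ^ (ℓ + 2)) ≤ Real.log (θ * a) := by
    rw [Real.log_mul hω.ne' (pow_ne_zero _ (by linarith)), Real.log_pow]
    push_cast
    linarith
  have h3 := (Real.log_le_log_iff
    (mul_pos hω (pow_pos (by linarith) _)) (mul_pos hθ ha)).1 h2
  rw [div_le_iff₀ hθ]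
  linarith

/-- The required number of walks makes the failure probability small. -/
lemma failure_probability_le {η p δ r : ℝ} (hη : 0 < η) (hp : 0 < p) (hδ : 0 < δ)
    (hr : 3 / (η ^ 2 * p) * Real.log (2 / δ) ≤ r) :
    2 * Real.exp (-(η ^ 2 / 3) * (r * p)) ≤ δ := by
  have h1 : Real.log (2 / δ) ≤ η ^ 2 / 3 * (r * p) := by
    rw [div_mul_eq_mul_div, div_le_iff₀ (by positivity)] at hr
    linarith
  have h2 : 2 / δ ≤ Real.exp (η ^ 2 / 3 * (r * p)) :=
    (Real.log_le_iff_le_exp (by positivity)).1 h1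
  rw [neg_mul, Real.exp_neg, ← div_eq_mul_inv, div_le_iff₀ (Real.exp_pos _)]
  rwa [div_le_iff₀' hδ] at h2

end FJ

theorem theorem2 {n : ℕ} (W : Matrix (Fin n) (Fin n) ℝ) (stub : Fin n → ℝ) (ω θ ε δ σ : ℝ)
    (S : Finset (Fin n)) (r ℓ : ℕ)
    (hW : W ∈ Matrix.rowStochastic ℝ (Fin n)) (hconn : FJ.StronglyConnected W)
    (hω : ω ∈ Set.Ioo (0 : ℝ) 1)
    (hθ : 0 < θ) (hstub : ∀ i, stub i ∈ Set.Icc θ 1)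
    (hS : ∃ i ∈ S, stub i < 1)
    (hε : ε ∈ Set.Ioo (0 : ℝ) 1) (hδ : δ ∈ Set.Ioo (0 : ℝ) 1) (hσ : σ ∈ Set.Ioo (0 : ℝ) 1)
    (hr : (r : ℝ) ≥ 3 / (σ ^ 2 * ε ^ 2 * FJ.spTrunc W stub ω S ℓ) * Real.log (2 / δ))
    (hℓ : (ℓ : ℝ) ≥
      (Real.log (θ * (1 - σ) * ε * FJ.spTrunc W stub ω S ℓ) - Real.log ω) / Real.log (1 - θ) - 2)
    {Ω : Type*} [MeasurableSpace Ω] (μ : MeasureTheory.Measure Ω)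
    [MeasureTheory.IsProbabilityMeasure μ]
    -- `r` independent walks, each with `ℓ` steps before the last one, which may be absorbing
    (Y : Fin r → Ω → Fin (ℓ + 1 + 1) → FJ.State n)
    (hY : ∀ k, FJ.IsWalk μ W stub ω S (Y k)) (hindep : ProbabilityTheory.iIndepFun Y μ) :
    μ.real {x | |FJ.spApx (fun k => Y k x) - FJ.sp₀ W stub ω S| < ε * FJ.spTrunc W stub ω S ℓ} ≥
      1 - δ := by
  have hstub1 : ∀ i, stub i ≤ 1 := fun i => (hstub i).2
  have hθ1 : θ < 1 := by
    obtain ⟨i, _, hi⟩ := hS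
    exact (hstub i).1.trans_lt hi
  have hn : 0 < n := by
    obtain ⟨i, _⟩ := hS
    exact i.pos
  have hp := FJ.spTrunc_pos hW hω hstub1 hS ℓ
  set p := FJ.spTrunc W stub ω S ℓ with hp_def
  have hη : 0 < σ * ε := mul_pos hσ.1 hε.1
  have hη1 : σ * ε ≤ 1 := mul_le_one₀ hσ.2.le hε.1.le hε.2.le
  have hlog : 0 < Real.log (2 / δ) :=
    Real.log_pos ((one_lt_div hδ.1).2 (by linarith [hδ.2]))
  rw [← mul_pow] at hr
  -- The estimate divides by `r`, so `r = 0` must be excluded; positivity of `log (2 / δ)` does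
  -- this.
  have hr0 : 0 < r := by
    have h : (0 : ℝ) < r := lt_of_lt_of_le (by positivity) hr
    exact_mod_cast h
  have htrunc : |p - FJ.sp₀ W stub ω S| ≤ (1 - σ) * ε * p := by
    refine (FJ.abs_spTrunc_sub_sp₀_le hn hW hω hθ hstub hθ1.le ℓ).trans ?_
    refine FJ.truncation_error_le hω.1 hθ hθ1
      (mul_pos (mul_pos (sub_pos.2 hσ.2) hε.1) hp) ?_
    simpa only [mul_assoc] using hℓ
  have hfail := (FJ.measureReal_abs_spApx_sub_ge_le hY hindep hr0 hp.le hη.le hη1).trans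
    (FJ.failure_probability_le hη hp hδ.1 hr)
  rw [← hp_def] at hfail
  -- Covering the whole space by the good and the bad event, rather than taking complements, needs
  -- no measurability of either.
  have hunion : μ.real Set.univ ≤
      μ.real {x | |FJ.spApx (fun k => Y k x) - FJ.sp₀ W stub ω S| < ε * p} +
        μ.real {x | σ * ε * p ≤ |FJ.spApx (fun k => Y k x) - p|} := by
    refine (MeasureTheory.measureReal_mono fun x _ => ?_).trans
      (MeasureTheory.measureReal_union_le _ _)
    rw [Set.mem_union, or_iff_not_imp_right]
    intro hx
    simp only [Set.mem_ofPred_eq, not_le] at hx ⊢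
    linarith [abs_sub_le (FJ.spApx fun k => Y k x) p (FJ.sp₀ W stub ω S)]
  rw [MeasureTheory.probReal_univ] at hunion
  linarith
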